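/- Let $p\neq\ell$ be primes, let $\mathbb F_q$ be a finite field of characteristic $p$ with algebraic closure $\mathbf k$, and let $\varepsilon\in\overline{\mathbb Q}_\ell$ be a square root of $q$. For $\mathbf d=(d_0,d_1)\in\mathbb N^2$ let $E_{\mathbf d}=\mathrm{Hom}(\mathbb F_q^{d_0},\mathbb F_q^{d_1})^{2}$ be the space of representations $x=(x_1,x_2)$ over $\mathbb F_q$ of the Kronecker quiver (vertices $0,1$ and two arrows $0\to 1$). Consider the $\overline{\mathbb Q}_\ell$-algebra of families of functions $E_{\mathbf d}\to\overline{\mathbb Q}_\ell$ $(\mathbf d\in\mathbb N^2)$ constant on isomorphism classes, with the twisted Hall product $$(f*g)(x)=\sum_{W}\varepsilon^{-m(\dim V/W,\;\dim W)}\,f(x|_{V/W})\,g(x|_{W}),\qquad m(\mathbf b,\mathbf c)=2b_0c_1+b_0c_0+b_1c_1,$$ where $W$ runs over the $x$-stable graded subspaces of $V=(\mathbb F_q^{d_0},\mathbb F_q^{d_1})$. Let $\theta_0,\theta_1$ be the indicator functions of the one-point spaces $E_{(1,0)},E_{(0,1)}$. Put $[n]_\varepsilon=(\varepsilon^n-\varepsilon^{-n})/(\varepsilon-\varepsilon^{-1})$,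 $[n]_\varepsilon!=[1]_\varepsilon\cdots[n]_\varepsilon$ and $\theta_i^{(n)}=\theta_i^n/[n]_\varepsilon!$. Let $\mathcal F$ be the $\mathbb Z[\varepsilon,\varepsilon^{-1}]$-subalgebra generated by all divided powers $\theta_i^{(n)}$ ($i\in\{0,1\}$, $n\ge 0$). A representation $((\mathbf k^n,\mathbf k^n),x_1,x_2)$ over $\mathbf k$ is called regular indecomposable if there is a point $[\lambda_0:\mu_0]\in\mathbb P^1(\mathbf k)$ such that $\lambda x_1+\mu x_2$ is invertible for all $[\lambda:\mu]\ne[\lambda_0:\mu_0]$ and $\lambda_0x_1+\mu_0x_2$ has a one-dimensional kernel; a representation over $\mathbf k$ is regular if it is isomorphic to a finite (possibly empty) direct sum of regular indecomposable ones. For $d\ge 0$ let $E^r_{(d,d)}\subseteq E_{(d,d)}$ be the set of those $x$ that become regular over $\mathbf k$, and let $\rho_d=\varepsilon^{-\dim E_{(d,d)}}\,1_{E^r_{(d,d)}}$ (so $\rho_0=1$). Then $\rho_d\in\mathcal F$ for every $d\ge 0$. In particular, $\rho_d$ lies in the $\overline{\mathbb Q}_\ell$-subalgebra generated by $\theta_0$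 and $\theta_1$. -/

import Mathlib

open scoped TensorProduct

noncomputable section

namespace Kronecker

/-! ### Representations of the Kronecker quiver (two arrows, both from vertex `0` to vertex `1`) -/

/-- The representation space `Hom(V₀, V₁) ⊕ Hom(V₀, V₁)` of the Kronecker quiver on the graded
vector space `(V₀, V₁)`; the two arrows are indexed by `Fin 2`. -/
abbrev Rep (K : Type*) [Field K] (V₀ V₁ : Type*) [AddCommGroup V₀] [Module K V₀]
    [AddCommGroup V₁] [Module K V₁] : Type _ :=
  Fin 2 → (V₀ →ₗ[K] V₁)

/-- The representation space `E_d` on the standard graded vector space of dimension vector `d`. -/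
abbrev E (K : Type*) [Field K] (d : ℕ × ℕ) : Type _ :=
  Rep K (Fin d.1 → K) (Fin d.2 → K)

section Basic

variable {K : Type*} [Field K]
variable {V₀ V₁ : Type*} [AddCommGroup V₀] [Module K V₀] [AddCommGroup V₁] [Module K V₁]
variable {V₀' V₁' : Type*} [AddCommGroup V₀'] [Module K V₀'] [AddCommGroup V₁'] [Module K V₁']
variable {V₀'' V₁'' : Type*} [AddCommGroup V₀''] [Module K V₀''] [AddCommGroup V₁'']
  [Module K V₁'']

/-- Isomorphism of representations. For two points of the same `E_d` this says that they lie in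
the same orbit of `GL_{d.1} × GL_{d.2}`. -/
def Iso (x : Rep K V₀ V₁) (y : Rep K V₀' V₁') : Prop :=
  ∃ (e₀ : V₀ ≃ₗ[K] V₀') (e₁ : V₁ ≃ₗ[K] V₁'), ∀ a v, e₁ (x a v) = y a (e₀ v)

theorem Iso.refl (x : Rep K V₀ V₁) : Iso x x :=
  ⟨LinearEquiv.refl K V₀, LinearEquiv.refl K V₁, fun _ _ => rfl⟩

theorem Iso.symm {x : Rep K V₀ V₁} {y : Rep K V₀' V₁'} (h : Iso x y) : Iso y x := by
  obtain ⟨e₀, e₁, h⟩ := h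
  refine ⟨e₀.symm, e₁.symm, fun a v => ?_⟩
  rw [LinearEquiv.symm_apply_eq, h, LinearEquiv.apply_symm_apply]

theorem Iso.trans {x : Rep K V₀ V₁} {y : Rep K V₀' V₁'} {z : Rep K V₀'' V₁''}
    (h : Iso x y) (h' : Iso y z) : Iso x z := by
  obtain ⟨e₀, e₁, h⟩ := h
  obtain ⟨f₀, f₁, h'⟩ := h'
  exact ⟨e₀.trans f₀, e₁.trans f₁, fun a v => by simp [h, h']⟩

/-- The dimension vector of a representation. -/
def dim (_x : Rep K V₀ V₁) : ℕ × ℕ := (Module.finrank K V₀, Module.finrank K V₁)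

theorem Iso.dim_eq {x : Rep K V₀ V₁} {y : Rep K V₀' V₁'} (h : Iso x y) : dim x = dim y := by
  obtain ⟨e₀, e₁, -⟩ := h
  simp [dim, e₀.finrank_eq, e₁.finrank_eq]

/-! ### Subrepresentations and quotients -/

/-- A subrepresentation of `x`: a graded subspace stable under `x`. -/
@[ext] structure Subrep (x : Rep K V₀ V₁) where
  W₀ : Submodule K V₀
  W₁ : Submodule K V₁
  stable : ∀ a, W₀ ≤ W₁.comap (x a)

/-- The representation induced on a stable graded subspace. -/
def Subrep.sub {x : Rep K V₀ V₁} (W : Subrep x) : Rep K W.W₀ W.W₁ :=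
  fun a => (x a).restrict (W.stable a)

/-- The representation induced on the quotient by a stable graded subspace. -/
def Subrep.quot {x : Rep K V₀ V₁} (W : Subrep x) : Rep K (V₀ ⧸ W.W₀) (V₁ ⧸ W.W₁) :=
  fun a => W.W₀.mapQ W.W₁ (x a) (W.stable a)

instance Subrep.instFinite [Finite V₀] [Finite V₁] (x : Rep K V₀ V₁) : Finite (Subrep x) :=
  Finite.of_injective (fun W : Subrep x => (W.W₀, W.W₁)) (by
    intro W W' h
    simp only [Prod.mk.injEq] at h
    exact Subrep.ext h.1 h.2)

instance Subrep.instFintype [Finite V₀] [Finite V₁] (x : Rep K V₀ V₁) : Fintype (Subrep x) :=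
  Fintype.ofFinite _

end Basic

/-! ### Regular representations -/

section Regular

variable {k : Type*} [Field k]

/-- A representation `((kⁿ, kⁿ), x₁, x₂)` is regular indecomposable if there is a point
`[l₀ : m₀]` of the projective line such that `l x₁ + m x₂` is invertible at all other points
`[l : m]`, and `l₀ x₁ + m₀ x₂` has a one-dimensional kernel. -/
def IsRegularIndecomposable {n : ℕ} (x : Rep k (Fin n → k) (Fin n → k)) : Prop :=
  ∃ l₀ m₀ : k, (l₀, m₀) ≠ (0, 0) ∧
    (∀ l m : k, l * m₀ ≠ m * l₀ → Function.Bijective (l • x 0 + m • x 1)) ∧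
    Module.finrank k (LinearMap.ker (l₀ • x 0 + m₀ • x 1)) = 1

/-- The direct sum of a finite family of representations. -/
def directSum {r : ℕ} {n : Fin r → ℕ} (y : ∀ j, Rep k (Fin (n j) → k) (Fin (n j) → k)) :
    Rep k (∀ j, Fin (n j) → k) (∀ j, Fin (n j) → k) :=
  fun a => LinearMap.pi fun j => y j a ∘ₗ LinearMap.proj j

variable {V₀ V₁ : Type*} [AddCommGroup V₀] [Module k V₀] [AddCommGroup V₁] [Module k V₁]
variable {V₀' V₁' : Type*} [AddCommGroup V₀'] [Module k V₀'] [AddCommGroup V₁'] [Module k V₁']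

/-- A representation (over an algebraically closed field) is regular if it is a direct sum of
regular indecomposable representations; the zero representation is regular. -/
def IsRegularRep (x : Rep k V₀ V₁) : Prop :=
  ∃ (r : ℕ) (n : Fin r → ℕ) (y : ∀ j, Rep k (Fin (n j) → k) (Fin (n j) → k)),
    (∀ j, IsRegularIndecomposable (y j)) ∧ Iso x (directSum y)

/-- Extension of scalars to an algebraic closure. -/
def geom (x : Rep k V₀ V₁) :
    Rep (AlgebraicClosure k) (AlgebraicClosure k ⊗[k] V₀) (AlgebraicClosure k ⊗[k] V₁) :=
  fun a => (x a).baseChange (AlgebraicClosure k)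

theorem Iso.geom {x : Rep k V₀ V₁} {y : Rep k V₀' V₁'} (h : Iso x y) :
    Iso (geom x) (geom y) := by
  obtain ⟨e₀, e₁, h⟩ := h
  refine ⟨e₀.baseChange k (AlgebraicClosure k) V₀ V₀', e₁.baseChange k (AlgebraicClosure k) V₁ V₁',
    fun a v => ?_⟩
  induction v with
  | zero => simp
  | add u v hu hv => simp only [map_add, hu, hv]
  | tmul c v => simp [Kronecker.geom, h]

end Regular

/-! ### Invariant functions and the (twisted) Hall product -/

section Hall

variable (K : Type*) [Field K] (R : Type*) [Field R]

/-- The families of `R`-valued functions on the spaces `E_d` (`d ∈ ℕ²`) that are constant on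
orbits. -/
def invariantFunctions : Submodule R (∀ d : ℕ × ℕ, E K d → R) where
  carrier := {f | ∀ d (x y : E K d), Iso x y → f d x = f d y}
  add_mem' := fun hf hg d x y h => by simp [hf d x y h, hg d x y h]
  zero_mem' := fun d x y h => rfl
  smul_mem' := fun c f hf d x y h => by simp [hf d x y h]

/-- The space of invariant functions on the spaces `E_d`, viewed as the underlying module of the
Hall algebra with twist parameter `ε`. -/
def HallAlgebra (_ε : R) : Type _ := invariantFunctions K R

variable {K R} {ε : R}

namespace HallAlgebra

instance : AddCommGroup (HallAlgebra K R ε) :=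
  inferInstanceAs (AddCommGroup (invariantFunctions K R))

instance : Module R (HallAlgebra K R ε) :=
  inferInstanceAs (Module R (invariantFunctions K R))

/-- The function on `E_d` given by an element of the Hall algebra. -/
def fn (f : HallAlgebra K R ε) (d : ℕ × ℕ) (x : E K d) : R := f.1 d x

theorem fn_congr (f : HallAlgebra K R ε) {d : ℕ × ℕ} {x y : E K d} (h : Iso x y) :
    f.fn d x = f.fn d y := f.2 d x y h

@[ext] theorem ext' {f g : HallAlgebra K R ε} (h : ∀ d x, f.fn d x = g.fn d x) : f = g :=
  Subtype.ext (funext fun d => funext fun x => h d x)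

/-- An element of the Hall algebra, given by an invariant family of functions. -/
def mk (f : ∀ d : ℕ × ℕ, E K d → R) (hf : ∀ d (x y : E K d), Iso x y → f d x = f d y) :
    HallAlgebra K R ε := ⟨f, hf⟩

@[simp] theorem fn_mk (f : ∀ d : ℕ × ℕ, E K d → R) (hf) (d : ℕ × ℕ) (x : E K d) :
    (mk f hf : HallAlgebra K R ε).fn d x = f d x := rfl

@[simp] theorem fn_add (f g : HallAlgebra K R ε) (d : ℕ × ℕ) (x : E K d) :
    (f + g).fn d x = f.fn d x + g.fn d x := rfl

@[simp] theorem fn_zero (d : ℕ × ℕ) (x : E K d) : (0 : HallAlgebra K R ε).fn d x = 0 := rfl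

@[simp] theorem fn_smul (c : R) (f : HallAlgebra K R ε) (d : ℕ × ℕ) (x : E K d) :
    (c • f).fn d x = c * f.fn d x := rfl

end HallAlgebra

variable {V₀ V₁ : Type*} [AddCommGroup V₀] [Module K V₀] [AddCommGroup V₁] [Module K V₁]
variable {V₀' V₁' : Type*} [AddCommGroup V₀'] [Module K V₀'] [AddCommGroup V₁'] [Module K V₁']

/-- A representation on arbitrary finite-dimensional spaces, written in bases. -/
def std [FiniteDimensional K V₀] [FiniteDimensional K V₁] (x : Rep K V₀ V₁) : E K (dim x) :=
  fun a => (Module.finBasis K V₁).equivFun.toLinearMap ∘ₗ x a ∘ₗ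
    (Module.finBasis K V₀).equivFun.symm.toLinearMap

theorem iso_std [FiniteDimensional K V₀] [FiniteDimensional K V₁] (x : Rep K V₀ V₁) :
    Iso x (std x) :=
  ⟨(Module.finBasis K V₀).equivFun, (Module.finBasis K V₁).equivFun, fun a v => by
    change _ = (Module.finBasis K V₁).equivFun (x a ((Module.finBasis K V₀).equivFun.symm
      ((Module.finBasis K V₀).equivFun v)))
    rw [LinearEquiv.symm_apply_apply]
    rfl⟩

namespace HallAlgebra

/-- The value of an invariant function at a representation on arbitrary finite-dimensional spaces;
by invariance it does not depend on the bases. -/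
def val [FiniteDimensional K V₀] [FiniteDimensional K V₁] (f : HallAlgebra K R ε)
    (x : Rep K V₀ V₁) : R := f.fn (dim x) (std x)

theorem val_eq_fn [FiniteDimensional K V₀] [FiniteDimensional K V₁] (f : HallAlgebra K R ε)
    (x : Rep K V₀ V₁) {d : ℕ × ℕ} (z : E K d) (h : Iso x z) : f.val x = f.fn d z := by
  have hd : d = dim x := by
    rw [h.dim_eq]
    simp [dim]
  subst hd
  exact f.fn_congr ((iso_std x).symm.trans h)

theorem val_congr [FiniteDimensional K V₀] [FiniteDimensional K V₁] [FiniteDimensional K V₀']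
    [FiniteDimensional K V₁'] (f : HallAlgebra K R ε) {x : Rep K V₀ V₁} {y : Rep K V₀' V₁'}
    (h : Iso x y) : f.val x = f.val y :=
  f.val_eq_fn x (std y) (h.trans (iso_std y))

end HallAlgebra

namespace HallAlgebra

open Classical in
/-- The unit: the indicator function of the zero representation. -/
instance : One (HallAlgebra K R ε) where
  one := mk (fun d _ => if d = 0 then 1 else 0) fun _ _ _ _ => rfl

open Classical in
theorem fn_one (d : ℕ × ℕ) (x : E K d) :
    (1 : HallAlgebra K R ε).fn d x = if d = 0 then 1 else 0 := rfl

theorem val_one [FiniteDimensional K V₀] [FiniteDimensional K V₁] (x : Rep K V₀ V₁) :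
    (1 : HallAlgebra K R ε).val x = if dim x = 0 then 1 else 0 := by
  classical
  rw [val, fn_one]

end HallAlgebra

/-- The exponent `m(b, c) = 2 b₀ c₁ + b₀ c₀ + b₁ c₁` of the twist. -/
def twist (b c : ℕ × ℕ) : ℕ := 2 * b.1 * c.2 + b.1 * c.1 + b.2 * c.2

namespace HallAlgebra

/-- The contribution of a subrepresentation `W` to the product `f * g`: the first factor is
evaluated at the quotient, the second one at `W`. -/
def term [FiniteDimensional K V₀] [FiniteDimensional K V₁] (f g : HallAlgebra K R ε)
    {x : Rep K V₀ V₁} (W : Subrep x) : R :=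
  ε⁻¹ ^ twist (dim W.quot) (dim W.sub) * (f.val W.quot * g.val W.sub)

end HallAlgebra

/-- Transport of subrepresentations along an isomorphism. -/
theorem exists_subrep_equiv {x : Rep K V₀ V₁} {y : Rep K V₀' V₁'} (h : Iso x y) :
    ∃ e : Subrep x ≃ Subrep y, ∀ W, Iso W.sub (e W).sub ∧ Iso W.quot (e W).quot := by
  obtain ⟨e₀, e₁, h⟩ := h
  have h' : ∀ a v, x a (e₀.symm v) = e₁.symm (y a v) := fun a v => by
    rw [LinearEquiv.eq_symm_apply, h, LinearEquiv.apply_symm_apply]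
  refine ⟨⟨fun W => ⟨W.W₀.map e₀.toLinearMap, W.W₁.map e₁.toLinearMap, fun a => ?_⟩,
    fun W => ⟨W.W₀.comap e₀.toLinearMap, W.W₁.comap e₁.toLinearMap, fun a v hv => ?_⟩,
    fun W => ?_, fun W => ?_⟩, fun W => ⟨?_, ?_⟩⟩
  · rintro _ ⟨v, hv, rfl⟩
    exact ⟨x a v, W.stable a hv, h a v⟩
  · have := W.stable a hv
    simpa [h] using this
  · ext v <;> simp
  · ext v <;> simp
  · exact ⟨e₀.submoduleMap W.W₀, e₁.submoduleMap W.W₁, fun a v => Subtype.ext (h a v)⟩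
  · refine ⟨Submodule.Quotient.equiv _ _ e₀ rfl, Submodule.Quotient.equiv _ _ e₁ rfl,
      fun a v => ?_⟩
    obtain ⟨v, rfl⟩ := Submodule.Quotient.mk_surjective _ v
    exact congrArg _ (h a v)

namespace HallAlgebra

theorem sum_term_congr [Finite V₀] [Finite V₁] [Finite V₀'] [Finite V₁']
    (f g : HallAlgebra K R ε) {x : Rep K V₀ V₁} {y : Rep K V₀' V₁'} (h : Iso x y) :
    ∑ W : Subrep x, term f g W = ∑ W : Subrep y, term f g W := by
  obtain ⟨e, he⟩ := exists_subrep_equiv h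
  refine Fintype.sum_equiv e _ _ fun W => ?_
  obtain ⟨h₁, h₂⟩ := he W
  simp only [term, f.val_congr h₂, g.val_congr h₁, h₁.dim_eq, h₂.dim_eq]

end HallAlgebra

theorem dim_eq_add [Finite V₀] [Finite V₁] {x : Rep K V₀ V₁} (W : Subrep x) :
    dim x = dim W.quot + dim W.sub := by
  simp only [dim, Prod.mk_add_mk, Submodule.finrank_quotient_add_finrank]

/-- The intersection of the subrepresentation `W` with `W'`, as a subrepresentation of `W'`. -/
def Subrep.under {x : Rep K V₀ V₁} (W W' : Subrep x) : Subrep W'.sub where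
  W₀ := W.W₀.comap W'.W₀.subtype
  W₁ := W.W₁.comap W'.W₁.subtype
  stable := fun a _ hv => W.stable a hv

/-- Subrepresentations of `W'` are the subrepresentations of `x` contained in `W'`. -/
theorem exists_subrep_sub_equiv {x : Rep K V₀ V₁} (W' : Subrep x) :
    ∃ e : {W : Subrep x // W.W₀ ≤ W'.W₀ ∧ W.W₁ ≤ W'.W₁} ≃ Subrep W'.sub,
      ∀ W, e W = W.1.under W' ∧ Iso (e W).sub W.1.sub := by
  refine ⟨⟨fun W => W.1.under W', fun U => ⟨⟨U.W₀.map W'.W₀.subtype, U.W₁.map W'.W₁.subtype,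
    fun a => ?_⟩, Submodule.map_subtype_le _ _, Submodule.map_subtype_le _ _⟩, ?_, ?_⟩, ?_⟩
  · rintro _ ⟨v, hv, rfl⟩
    exact ⟨W'.sub a v, U.stable a hv, rfl⟩
  · rintro ⟨W, h₀, h₁⟩
    refine Subtype.ext (Subrep.ext ?_ ?_)
    · simpa [Subrep.under, Submodule.map_comap_subtype] using h₀
    · simpa [Subrep.under, Submodule.map_comap_subtype] using h₁
  · intro U
    refine Subrep.ext ?_ ?_
    · exact Submodule.comap_map_eq_of_injective W'.W₀.injective_subtype _
    · exact Submodule.comap_map_eq_of_injective W'.W₁.injective_subtype _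
  · rintro ⟨W, h₀, h₁⟩
    exact ⟨rfl, Submodule.comapSubtypeEquivOfLe h₀, Submodule.comapSubtypeEquivOfLe h₁,
      fun _ _ => rfl⟩

theorem exists_quotient_quotient_equiv (P Q : Submodule K V₀) (h : P ≤ Q) :
    ∃ e : ((V₀ ⧸ P) ⧸ Q.map P.mkQ) ≃ₗ[K] V₀ ⧸ Q, ∀ v : V₀,
      e (Submodule.Quotient.mk (Submodule.Quotient.mk v)) = Submodule.Quotient.mk v :=
  ⟨Submodule.quotientQuotientEquivQuotient P Q h, fun _ => rfl⟩

theorem exists_subquotient_equiv (P Q : Submodule K V₀) :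
    ∃ e : (Q ⧸ P.comap Q.subtype) ≃ₗ[K] Q.map P.mkQ,
      ∀ v : Q, (e (Submodule.Quotient.mk v) : V₀ ⧸ P) = Submodule.Quotient.mk (v : V₀) := by
  have hk : P.comap Q.subtype = LinearMap.ker (P.mkQ.submoduleMap Q) := by
    ext v
    rw [LinearMap.mem_ker, ← Submodule.coe_eq_zero]
    exact (Submodule.Quotient.mk_eq_zero P).symm
  exact ⟨(Submodule.quotEquivOfEq _ _ hk).trans
    ((P.mkQ.submoduleMap Q).quotKerEquivOfSurjective (P.mkQ.submoduleMap_surjective Q)),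
    fun v => rfl⟩

/-- The image of the subrepresentation `W'` in the quotient of `x` by `W`. -/
def Subrep.over {x : Rep K V₀ V₁} (W W' : Subrep x) : Subrep W.quot where
  W₀ := W'.W₀.map W.W₀.mkQ
  W₁ := W'.W₁.map W.W₁.mkQ
  stable := by
    rintro a _ ⟨v, hv, rfl⟩
    exact ⟨x a v, W'.stable a hv, rfl⟩

theorem Subrep.iso_over_sub {x : Rep K V₀ V₁} (W W' : Subrep x) :
    Iso (W.under W').quot (W.over W').sub := by
  obtain ⟨e₀, he₀⟩ := exists_subquotient_equiv W.W₀ W'.W₀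
  obtain ⟨e₁, he₁⟩ := exists_subquotient_equiv W.W₁ W'.W₁
  refine ⟨e₀, e₁, fun a v => ?_⟩
  obtain ⟨v, rfl⟩ := Submodule.Quotient.mk_surjective _ v
  refine Subtype.ext ?_
  refine (he₁ (W'.sub a v)).trans ?_
  exact (congrArg (W.quot a) (he₀ v)).symm

theorem Subrep.iso_over_quot {x : Rep K V₀ V₁} (W W' : Subrep x) (h₀ : W.W₀ ≤ W'.W₀)
    (h₁ : W.W₁ ≤ W'.W₁) : Iso (W.over W').quot W'.quot := by
  obtain ⟨f₀, hf₀⟩ := exists_quotient_quotient_equiv W.W₀ W'.W₀ h₀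
  obtain ⟨f₁, hf₁⟩ := exists_quotient_quotient_equiv W.W₁ W'.W₁ h₁
  refine ⟨f₀, f₁, fun a v => ?_⟩
  obtain ⟨v, rfl⟩ := Submodule.Quotient.mk_surjective _ v
  obtain ⟨v, rfl⟩ := Submodule.Quotient.mk_surjective _ v
  refine (hf₁ (x a v)).trans ?_
  exact (congrArg (W'.quot a) (hf₀ v)).symm

/-- Subrepresentations of `x / W` are the subrepresentations of `x` containing `W`. -/
theorem exists_subrep_quot_equiv {x : Rep K V₀ V₁} (W : Subrep x) :
    ∃ e : {W' : Subrep x // W.W₀ ≤ W'.W₀ ∧ W.W₁ ≤ W'.W₁} ≃ Subrep W.quot,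
      ∀ W', e W' = W.over W'.1 := by
  refine ⟨⟨fun W' => W.over W'.1,
    fun U => ⟨⟨U.W₀.comap W.W₀.mkQ, U.W₁.comap W.W₁.mkQ, fun a v hv => ?_⟩,
      Submodule.le_comap_mkQ _ _, Submodule.le_comap_mkQ _ _⟩, ?_, ?_⟩, fun _ => rfl⟩
  · exact U.stable a hv
  · rintro ⟨W', h₀, h₁⟩
    refine Subtype.ext (Subrep.ext ?_ ?_)
    · simpa [Subrep.over, Submodule.comap_map_mkQ] using h₀
    · simpa [Subrep.over, Submodule.comap_map_mkQ] using h₁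
  · intro U
    refine Subrep.ext ?_ ?_
    · exact Submodule.map_comap_eq_of_surjective W.W₀.mkQ_surjective _
    · exact Submodule.map_comap_eq_of_surjective W.W₁.mkQ_surjective _

variable [Finite K]

namespace HallAlgebra

/-- The Hall product: `(f * g)(x) = ∑_W ε^{-m(dim V/W, dim W)} f(x|_{V/W}) g(x|_W)`, the sum
over all `x`-stable graded subspaces `W` of `V`. -/
instance : Mul (HallAlgebra K R ε) where
  mul f g := mk (fun _ x => ∑ W : Subrep x, term f g W) fun _ _ _ h => sum_term_congr f g h

theorem fn_mul (f g : HallAlgebra K R ε) (d : ℕ × ℕ) (x : E K d) :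
    (f * g).fn d x = ∑ W : Subrep x, term f g W := rfl

theorem val_mul [Finite V₀] [Finite V₁] (f g : HallAlgebra K R ε) (x : Rep K V₀ V₁) :
    (f * g).val x = ∑ W : Subrep x, term f g W :=
  (sum_term_congr f g (iso_std x)).symm

end HallAlgebra

/-! The Hall product makes the invariant functions an associative unital algebra. -/

theorem twist_assoc (a b c : ℕ × ℕ) :
    twist (a + b) c + twist a b = twist a (b + c) + twist b c := by
  simp only [twist, Prod.fst_add, Prod.snd_add]
  ring

namespace HallAlgebra

theorem hall_mul_assoc (f g h : HallAlgebra K R ε) : f * g * h = f * (g * h) := by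
  classical
  ext d x
  let T : Subrep x → Subrep x → R := fun W W' =>
    ε⁻¹ ^ (twist (dim W'.quot) (dim W'.sub) +
      twist (dim (W.under W').quot) (dim (W.under W').sub)) *
      (f.val W'.quot * (g.val (W.under W').quot * h.val (W.under W').sub))
  have h₁ : ∀ W : Subrep x, term (f * g) h W =
      ∑ W' : {W' : Subrep x // W.W₀ ≤ W'.W₀ ∧ W.W₁ ≤ W'.W₁}, T W W'.1 := by
    intro W
    obtain ⟨e, he⟩ := exists_subrep_quot_equiv W
    have : Finite ((Fin d.1 → K) ⧸ W.W₀) := Finite.of_surjective _ W.W₀.mkQ_surjective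
    have : Finite ((Fin d.2 → K) ⧸ W.W₁) := Finite.of_surjective _ W.W₁.mkQ_surjective
    rw [term, val_mul, Finset.sum_mul, Finset.mul_sum]
    refine (Fintype.sum_equiv e _ _ fun W' => ?_).symm
    rw [he W']
    have i₁ := (W.iso_over_sub W'.1).symm
    have i₂ := W.iso_over_quot W'.1 W'.2.1 W'.2.2
    obtain ⟨e', he'⟩ := exists_subrep_sub_equiv W'.1
    have i₃ := (he' ⟨W, W'.2⟩).2
    rw [(he' ⟨W, W'.2⟩).1] at i₃
    have d₁ := dim_eq_add (W.over W'.1)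
    have d₂ := dim_eq_add (W.under W'.1)
    simp only [T, term, f.val_congr i₂, g.val_congr i₁, h.val_congr i₃, d₁, d₂, i₁.dim_eq,
      i₂.dim_eq, i₃.dim_eq, pow_add]
    have hp := congrArg (fun n : ℕ => ε⁻¹ ^ n) (twist_assoc (dim W'.1.quot)
      (dim (W.under W'.1).quot) (dim W.sub))
    simp only [pow_add] at hp
    linear_combination (-(f.val W'.1.quot * (g.val (W.under W'.1).quot * h.val W.sub))) * hp
  have h₂ : ∀ W' : Subrep x, term f (g * h) W' =
      ∑ W : {W : Subrep x // W.W₀ ≤ W'.W₀ ∧ W.W₁ ≤ W'.W₁}, T W.1 W' := by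
    intro W'
    obtain ⟨e, he⟩ := exists_subrep_sub_equiv W'
    rw [term, val_mul, Finset.mul_sum, Finset.mul_sum]
    refine (Fintype.sum_equiv e _ _ fun W => ?_).symm
    rw [(he W).1]
    simp only [T, term, pow_add]
    ring
  simp only [fn_mul, h₁, h₂]
  rw [Finset.sum_sigma', Finset.sum_sigma']
  exact Finset.sum_bij' (fun p _ => ⟨p.2.1, p.1, p.2.2⟩) (fun p _ => ⟨p.2.1, p.1, p.2.2⟩)
    (by simp) (by simp) (by simp) (by simp) (by simp)

theorem hall_one_mul (f : HallAlgebra K R ε) : 1 * f = f := by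
  classical
  ext d x
  rw [fn_mul]
  let W : Subrep x := ⟨⊤, ⊤, fun _ _ _ => trivial⟩
  have hW : Iso W.sub x := ⟨Submodule.topEquiv, Submodule.topEquiv, fun a v => rfl⟩
  have hd : ∀ W' : Subrep x, dim W'.quot = 0 ↔ W' = W := by
    intro W'
    constructor
    · intro h
      simp only [dim, Prod.mk_eq_zero, Module.finrank_zero_iff,
        Submodule.Quotient.subsingleton_iff] at h
      exact Subrep.ext h.1 h.2
    · rintro rfl
      exact Prod.ext (Module.finrank_zero_iff.2 (Submodule.Quotient.subsingleton_iff.2 rfl))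
        (Module.finrank_zero_iff.2 (Submodule.Quotient.subsingleton_iff.2 rfl))
  rw [Finset.sum_eq_single W]
  · simp [term, val_one, (hd W).2 rfl, twist, f.val_eq_fn _ _ hW]
  · intro W' _ h
    have h' : (1 : HallAlgebra K R ε).val W'.quot = 0 := by
      rw [val_one, if_neg (fun h' => h ((hd W').1 h'))]
    simp [term, h']
  · simp

theorem hall_mul_one (f : HallAlgebra K R ε) : f * 1 = f := by
  classical
  ext d x
  rw [fn_mul]
  let W : Subrep x := ⟨⊥, ⊥, fun a v hv => by
    rw [Submodule.mem_bot] at hv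
    simp [hv]⟩
  have hW : Iso W.quot x := ⟨Submodule.quotEquivOfEqBot _ rfl, Submodule.quotEquivOfEqBot _ rfl,
    fun a v => by
      obtain ⟨v, rfl⟩ := Submodule.Quotient.mk_surjective _ v
      rfl⟩
  have hd : ∀ W' : Subrep x, dim W'.sub = 0 ↔ W' = W := by
    intro W'
    constructor
    · intro h
      simp only [dim, Prod.mk_eq_zero, Submodule.finrank_eq_zero] at h
      exact Subrep.ext h.1 h.2
    · rintro rfl
      simp [dim, W]
  rw [Finset.sum_eq_single W]
  · simp [term, val_one, (hd W).2 rfl, twist, f.val_eq_fn _ _ hW]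
  · intro W' _ h
    simp [term, val_one, hd, h]
  · simp

instance : Ring (HallAlgebra K R ε) where
  __ := (inferInstance : AddCommGroup (HallAlgebra K R ε))
  neg_add_cancel := neg_add_cancel
  mul_assoc := hall_mul_assoc
  one_mul := hall_one_mul
  mul_one := hall_mul_one
  zero_mul f := by
    ext d x
    simp [fn_mul, term, val]
  mul_zero f := by
    ext d x
    simp [fn_mul, term, val]
  left_distrib f g h := by
    ext d x
    simp [fn_mul, term, val, mul_add, Finset.sum_add_distrib]
  right_distrib f g h := by
    ext d x
    simp [fn_mul, term, val, mul_add, add_mul, Finset.sum_add_distrib]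

instance : Algebra R (HallAlgebra K R ε) :=
  Algebra.ofModule
    (fun c f g => by
      ext d x
      simp only [fn_mul, fn_smul, Finset.mul_sum, term, val]
      exact Finset.sum_congr rfl fun _ _ => by ring)
    (fun c f g => by
      ext d x
      simp only [fn_mul, fn_smul, Finset.mul_sum, term, val]
      exact Finset.sum_congr rfl fun _ _ => by ring)

end HallAlgebra

/-! ### The composition algebra and the functions `ρ_d` -/

variable (K) (ε)

open Classical in
/-- The generator `θ_i` (`i ∈ ℤ/2`): the indicator function of `E_d` (a point) for `d` the
dimension vector of the simple representation at the vertex `i`. -/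
def theta (i : ZMod 2) : HallAlgebra K R ε :=
  HallAlgebra.mk (fun d _ => if d = (if i = 0 then (1, 0) else (0, 1)) then 1 else 0)
    fun _ _ _ _ => rfl

variable {K}

/-- The quantum integer `[n]_ε = (ε^n - ε^{-n}) / (ε - ε^{-1})`. -/
def qInt (n : ℕ) : R := (ε ^ n - ε⁻¹ ^ n) / (ε - ε⁻¹)

/-- The quantum factorial `[n]_ε! = [1]_ε [2]_ε ⋯ [n]_ε`. -/
def qFactorial (n : ℕ) : R := ∏ j ∈ Finset.range n, qInt ε (j + 1)

variable (K)

/-- The divided power `θ_i^{(n)} = θ_i^n / [n]_ε!`. -/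
def thetaDiv (i : ZMod 2) (n : ℕ) : HallAlgebra K R ε := (qFactorial ε n)⁻¹ • theta K ε i ^ n

/-- The ring `𝒜_ε = ℤ[ε, ε⁻¹]`. -/
def laurent : Subalgebra ℤ R := Algebra.adjoin ℤ {ε, ε⁻¹}

/-- The (integral form of the) composition algebra: the `ℤ[ε, ε⁻¹]`-subalgebra of the Hall algebra
generated by the divided powers of `θ_0` and `θ_1`. -/
def compositionAlgebra : Subalgebra (laurent ε) (HallAlgebra K R ε) :=
  Algebra.adjoin (laurent ε) {f | ∃ (i : ZMod 2) (n : ℕ), f = thetaDiv K ε i n}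

open Classical in
/-- The function `ρ_d = ε^{-dim E_{(d,d)}} 1_{E_{(d,d)}^r}`. A point of `E_{(d,d)}` over the finite
field `K` is in the regular locus if it is regular over the algebraic closure of `K`. -/
def rho (d : ℕ) : HallAlgebra K R ε :=
  HallAlgebra.mk
    (fun e x => if e = (d, d) ∧ IsRegularRep (geom x) then ε⁻¹ ^ Module.finrank K (E K (d, d)) else 0)
    fun _ x y h => by
      have : IsRegularRep (geom x) ↔ IsRegularRep (geom y) :=
        ⟨fun ⟨r, n, z, hz, i⟩ => ⟨r, n, z, hz, h.geom.symm.trans i⟩,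
          fun ⟨r, n, z, hz, i⟩ => ⟨r, n, z, hz, h.geom.trans i⟩⟩
      simp only [this]

end Hall

end Kronecker

end

noncomputable section

namespace Kronecker

/-! ### The torsion pair given by the defect `dim V₀ - dim V₁` -/

section TorsionPair

variable {K : Type*} [Field K]
variable {V₀ V₁ : Type*} [AddCommGroup V₀] [Module K V₀] [AddCommGroup V₁] [Module K V₁]
variable {V₀' V₁' : Type*} [AddCommGroup V₀'] [Module K V₀'] [AddCommGroup V₁'] [Module K V₁']

/-! The defect `dim V₀ - dim V₁` is additive on short exact sequences, so it cuts out a torsion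
pair: every representation has exactly one torsion subrepresentation with torsion-free quotient
(`Subrep.existsUnique_isTorsion_isTorsionFree`). In the Hall algebra this becomes the identity
`indAll_eq_sum`, which writes the constant function on `E_d` as a sum of products (torsion-free
part) * (torsion part), rescaled by powers of `ε` that cancel the twist.

The constant functions lie in the composition algebra: `θ_i^{(n)}` is the constant function in
dimension `n • simpleDim i`, and `indAll_eq_thetaDiv_mul_thetaDiv` multiplies two of these. The
identity can be inverted by induction on total dimension: a nonzero torsion representation has
positive defect and a torsion-free one has defect at most zero, so for each `d ≠ 0` only one of the
two extreme terms survives. Hence all torsion-free indicators lie in the algebra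
(`indTorsion_mem_of_indAll_mem`).

In dimension `(d, d)` torsion-free means geometrically regular (`isRegularRep_geom_iff`). Both
conditions say that `x 0 + t x 1` is invertible for some `t` in the algebraic closure. For
regularity this comes from the structure of modules over `k[X]`; for torsion-freeness, a pencil with
identically zero determinant has a polynomial kernel vector, whose coefficients span a subspace
generating a subrepresentation of positive defect. -/

/-- No subrepresentation has positive defect. -/
def IsTorsionFree (x : Rep K V₀ V₁) : Prop :=
  ∀ W : Subrep x, (dim W.sub).1 ≤ (dim W.sub).2

/-- Every nonzero quotient has positive defect. -/
def IsTorsion (x : Rep K V₀ V₁) : Prop :=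
  ∀ W : Subrep x, dim W.quot ≠ 0 → (dim W.quot).2 < (dim W.quot).1

theorem Iso.isTorsionFree_iff {x : Rep K V₀ V₁} {y : Rep K V₀' V₁'} (h : Iso x y) :
    IsTorsionFree x ↔ IsTorsionFree y := by
  obtain ⟨e, he⟩ := exists_subrep_equiv h
  refine e.forall_congr fun W => ?_
  rw [(he W).1.dim_eq]

theorem Iso.isTorsion_iff {x : Rep K V₀ V₁} {y : Rep K V₀' V₁'} (h : Iso x y) :
    IsTorsion x ↔ IsTorsion y := by
  obtain ⟨e, he⟩ := exists_subrep_equiv h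
  refine e.forall_congr fun W => ?_
  rw [(he W).2.dim_eq]

variable (x : Rep K V₀ V₁)

/-- The zero subrepresentation. -/
def Subrep.zero : Subrep x := ⟨⊥, ⊥, fun a v hv => by simp_all⟩

/-- The whole representation as a subrepresentation of itself. -/
def Subrep.whole : Subrep x := ⟨⊤, ⊤, fun _ _ _ => trivial⟩

theorem Subrep.dim_whole_sub : dim (Subrep.whole x).sub = dim x :=
  Prod.ext (finrank_top K V₀) (finrank_top K V₁)

theorem Subrep.dim_zero_quot : dim (Subrep.zero x).quot = dim x :=
  Prod.ext (Submodule.quotEquivOfEqBot (⊥ : Submodule K V₀) rfl).finrank_eq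
    (Submodule.quotEquivOfEqBot (⊥ : Submodule K V₁) rfl).finrank_eq

variable {x}

theorem IsTorsionFree.le (h : IsTorsionFree x) : (dim x).1 ≤ (dim x).2 := by
  simpa only [Subrep.dim_whole_sub] using h (Subrep.whole x)

theorem IsTorsion.lt (h : IsTorsion x) (hx : dim x ≠ 0) : (dim x).2 < (dim x).1 := by
  rw [← Subrep.dim_zero_quot] at hx ⊢
  exact h _ hx

variable [Finite V₀] [Finite V₁]

theorem isTorsionFree_of_dim_eq_zero (hx : dim x = 0) : IsTorsionFree x := by
  intro W
  have := dim_eq_add W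
  rw [hx] at this
  simp [(add_eq_zero.1 this.symm).2]

theorem isTorsion_of_dim_eq_zero (hx : dim x = 0) : IsTorsion x := by
  intro W hW
  have := dim_eq_add W
  rw [hx] at this
  exact absurd (add_eq_zero.1 this.symm).1 hW

/-- The image of `W` in `x / W'` is a quotient of a torsion representation and a subrepresentation
of a torsion-free one, so it vanishes. -/
theorem Subrep.under_le_of_isTorsion {W W' : Subrep x} (hW : IsTorsion W.sub)
    (hW' : IsTorsionFree W'.quot) : W.W₀ ≤ W'.W₀ ∧ W.W₁ ≤ W'.W₁ := by
  have h₁ := hW (W'.under W)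
  have h₂ := hW' (W'.over W)
  rw [← (W'.iso_over_sub W).dim_eq] at h₂
  have h : dim (W'.under W).quot = 0 := by
    by_contra h
    exact absurd (h₁ h) h₂.not_gt
  rw [dim, Prod.mk_eq_zero] at h
  have h₀ := Submodule.Quotient.subsingleton_iff.1 (Module.finrank_zero_iff.1 h.1)
  have h₁ := Submodule.Quotient.subsingleton_iff.1 (Module.finrank_zero_iff.1 h.2)
  exact ⟨Submodule.comap_subtype_eq_top.1 h₀, Submodule.comap_subtype_eq_top.1 h₁⟩

/-- Take `W` of maximal defect and, among those, of minimal total dimension. A nonzero quotient of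
`W` of defect at most zero would leave a smaller kernel of no less defect; a subrepresentation of `x
/ W` of positive defect would pull back to one of larger defect. -/
theorem Subrep.exists_isTorsion_isTorsionFree (x : Rep K V₀ V₁) :
    ∃ W : Subrep x, IsTorsion W.sub ∧ IsTorsionFree W.quot := by
  let key : Subrep x → ℤ ×ₗ ℤ := fun W =>
    toLex (((dim W.sub).1 : ℤ) - (dim W.sub).2, -((dim W.sub).1 + (dim W.sub).2 : ℤ))
  have : Nonempty (Subrep x) := ⟨Subrep.zero x⟩
  obtain ⟨W, hW⟩ := Finite.exists_max key
  refine ⟨W, fun U hU => ?_, fun U => ?_⟩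
  · obtain ⟨e, he⟩ := exists_subrep_sub_equiv W
    obtain ⟨U', rfl⟩ := e.surjective U
    have h := hW U'.1
    rw [Prod.Lex.le_iff] at h
    have h₁ := (he U').2.dim_eq
    have h₂ := dim_eq_add (e U')
    rw [h₁] at h₂
    have h₃ : (dim (e U').quot).1 ≠ 0 ∨ (dim (e U').quot).2 ≠ 0 := by
      by_contra! h
      exact hU (Prod.ext h.1 h.2)
    have h₄ := congrArg Prod.fst h₂
    have h₅ := congrArg Prod.snd h₂
    simp only [Prod.fst_add, Prod.snd_add] at h₄ h₅
    simp only [key, ofLex_toLex] at h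
    omega
  · obtain ⟨e, he⟩ := exists_subrep_quot_equiv W
    obtain ⟨U', rfl⟩ := e.surjective U
    have h := hW U'.1
    rw [Prod.Lex.le_iff] at h
    obtain ⟨e', he'⟩ := exists_subrep_sub_equiv U'.1
    have h₁ := (he' ⟨W, U'.2⟩).2.dim_eq
    rw [(he' ⟨W, U'.2⟩).1] at h₁
    have h₂ := dim_eq_add (W.under U'.1)
    rw [h₁, (W.iso_over_sub U'.1).dim_eq, ← he] at h₂
    have h₄ := congrArg Prod.fst h₂
    have h₅ := congrArg Prod.snd h₂
    simp only [Prod.fst_add, Prod.snd_add] at h₄ h₅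
    simp only [key, ofLex_toLex] at h
    omega

theorem Subrep.existsUnique_isTorsion_isTorsionFree (x : Rep K V₀ V₁) :
    ∃! W : Subrep x, IsTorsion W.sub ∧ IsTorsionFree W.quot := by
  obtain ⟨W, hW⟩ := Subrep.exists_isTorsion_isTorsionFree x
  refine ⟨W, hW, fun W' hW' => ?_⟩
  have h₁ := Subrep.under_le_of_isTorsion hW.1 hW'.2
  have h₂ := Subrep.under_le_of_isTorsion hW'.1 hW.2
  exact Subrep.ext (h₂.1.antisymm h₁.1) (h₂.2.antisymm h₁.2)

end TorsionPair

/-! ### Indicator functions -/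

section Indicator

variable (K : Type*) [Field K] {R : Type*} [Field R] (ε : R)

open Classical in
/-- The indicator function of the representations of dimension vector `d`. -/
def indAll (d : ℕ × ℕ) : HallAlgebra K R ε :=
  HallAlgebra.mk (fun e _ => if e = d then 1 else 0) fun _ _ _ _ => rfl

open Classical in
/-- The indicator function of the torsion-free representations of dimension vector `d`. -/
def indTorsionFree (d : ℕ × ℕ) : HallAlgebra K R ε :=
  HallAlgebra.mk (fun e x => if e = d ∧ IsTorsionFree x then 1 else 0) fun _ _ _ h => by
    simp only [h.isTorsionFree_iff]

open Classical in
/-- The indicator function of the torsion representations of dimension vector `d`. -/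
def indTorsion (d : ℕ × ℕ) : HallAlgebra K R ε :=
  HallAlgebra.mk (fun e x => if e = d ∧ IsTorsion x then 1 else 0) fun _ _ _ h => by
    simp only [h.isTorsion_iff]

variable {K}
variable {V₀ V₁ : Type*} [AddCommGroup V₀] [Module K V₀] [AddCommGroup V₁] [Module K V₁]
  [FiniteDimensional K V₀] [FiniteDimensional K V₁]

open Classical in
theorem val_indAll (d : ℕ × ℕ) (x : Rep K V₀ V₁) :
    (indAll K ε d).val x = if dim x = d then 1 else 0 := rfl

open Classical in
theorem val_indTorsionFree (d : ℕ × ℕ) (x : Rep K V₀ V₁) :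
    (indTorsionFree K ε d).val x = if dim x = d ∧ IsTorsionFree x then 1 else 0 := by
  simp only [(iso_std x).isTorsionFree_iff]
  rfl

open Classical in
theorem val_indTorsion (d : ℕ × ℕ) (x : Rep K V₀ V₁) :
    (indTorsion K ε d).val x = if dim x = d ∧ IsTorsion x then 1 else 0 := by
  simp only [(iso_std x).isTorsion_iff]
  rfl

theorem dim_E {d : ℕ × ℕ} (x : E K d) : dim x = d := by
  simp [dim]

variable (K) [Finite K]

theorem indTorsionFree_zero : indTorsionFree K ε 0 = 1 := by
  classical
  ext d x
  rw [HallAlgebra.fn_one]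
  refine if_congr (and_iff_left_of_imp ?_) rfl rfl
  rintro rfl
  exact isTorsionFree_of_dim_eq_zero (dim_E x)

theorem indTorsion_zero : indTorsion K ε 0 = 1 := by
  classical
  ext d x
  rw [HallAlgebra.fn_one]
  refine if_congr (and_iff_left_of_imp ?_) rfl rfl
  rintro rfl
  exact isTorsion_of_dim_eq_zero (dim_E x)

theorem indTorsionFree_eq_zero {d : ℕ × ℕ} (h : d.2 < d.1) : indTorsionFree K ε d = 0 := by
  classical
  ext e x
  refine if_neg ?_
  rintro ⟨rfl, hx⟩
  have := hx.le
  rw [dim_E] at this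
  omega

theorem indTorsion_eq_zero {d : ℕ × ℕ} (hd : d ≠ 0) (h : d.1 ≤ d.2) : indTorsion K ε d = 0 := by
  classical
  ext e x
  refine if_neg ?_
  rintro ⟨rfl, hx⟩
  have := hx.lt (by rwa [dim_E])
  rw [dim_E] at this
  omega

/-- The pairs of dimension vectors with sum `d`. -/
def splittings (d : ℕ × ℕ) : Finset ((ℕ × ℕ) × (ℕ × ℕ)) :=
  (Finset.Iic d ×ˢ Finset.Iic d).filter fun p => p.1 + p.2 = d

theorem mem_splittings {d : ℕ × ℕ} {p : (ℕ × ℕ) × (ℕ × ℕ)} :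
    p ∈ splittings d ↔ p.1 + p.2 = d := by
  simp only [splittings, Finset.mem_filter, Finset.mem_product, Finset.mem_Iic,
    and_iff_right_iff_imp]
  rintro rfl
  exact ⟨le_self_add, le_add_self⟩

variable {ε}

theorem fn_sum {ι : Type*} (s : Finset ι) (f : ι → HallAlgebra K R ε) (d : ℕ × ℕ) (x : E K d) :
    (∑ i ∈ s, f i).fn d x = ∑ i ∈ s, (f i).fn d x := by
  classical
  induction s using Finset.induction_on with
  | empty => simp
  | insert a s ha ih => simp [Finset.sum_insert ha, ih]

/-- At each point exactly one pair (splitting, subrepresentation) contributes, the one given by the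
torsion subrepresentation, and its twist is cancelled by the coefficient. -/
theorem indAll_eq_sum (hε : ε ≠ 0) (d : ℕ × ℕ) :
    indAll K ε d =
      ∑ p ∈ splittings d, ε ^ twist p.1 p.2 • (indTorsionFree K ε p.1 * indTorsion K ε p.2) := by
  classical
  ext e x
  have hterm : ∀ (p : (ℕ × ℕ) × (ℕ × ℕ)) (W : Subrep x),
      ε ^ twist p.1 p.2 * (indTorsionFree K ε p.1).term (indTorsion K ε p.2) W =
        if (dim W.quot, dim W.sub) = p then
          if IsTorsion W.sub ∧ IsTorsionFree W.quot then 1 else 0 else 0 := by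
    intro p W
    rw [HallAlgebra.term, val_indTorsionFree, val_indTorsion]
    obtain ⟨b, c⟩ := p
    by_cases h₁ : dim W.quot = b
    · by_cases h₂ : dim W.sub = c
      · by_cases h₃ : IsTorsion W.sub <;> by_cases h₄ : IsTorsionFree W.quot <;>
          simp [h₁, h₂, h₃, h₄, hε]
      · simp [h₂]
    · simp [h₁]
  obtain ⟨W, hW, hu⟩ := Subrep.existsUnique_isTorsion_isTorsionFree x
  simp only [fn_sum, HallAlgebra.fn_smul, HallAlgebra.fn_mul, Finset.mul_sum, hterm]
  rw [Finset.sum_comm, Finset.sum_eq_single W]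
  · rw [if_pos hW, Finset.sum_ite_eq]
    simp only [mem_splittings, ← dim_eq_add W, dim_E]
    rfl
  · intro W' _ h
    simp only [if_neg fun h' => h (hu W' h'), ite_self, Finset.sum_const_zero]
  · simp

theorem indTorsion_mem_of_indAll_mem (hε : ε ≠ 0) (S : Subring (HallAlgebra K R ε))
    (hS : ∀ n : ℕ, ∀ f ∈ S, ε ^ n • f ∈ S) (hA : ∀ d, indAll K ε d ∈ S) (d : ℕ × ℕ) :
    indTorsionFree K ε d ∈ S ∧ indTorsion K ε d ∈ S := by
  classical
  induction hn : d.1 + d.2 using Nat.strong_induction_on generalizing d with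
  | _ n ih =>
  subst hn
  by_cases hd : d = 0
  · subst hd
    rw [indTorsionFree_zero, indTorsion_zero]
    exact ⟨S.one_mem, S.one_mem⟩
  have hm₁ : (d, 0) ∈ splittings d := mem_splittings.2 (add_zero d)
  -- The two splittings with a zero part carry the unknown indicators in dimension `d`; all others
  -- involve strictly smaller total dimension.
  have hne : ((0 : ℕ × ℕ), d) ≠ (d, 0) := fun h => hd (congrArg Prod.snd h)
  have hm₂ : (0, d) ∈ (splittings d).erase (d, 0) :=
    Finset.mem_erase.2 ⟨hne, mem_splittings.2 (zero_add d)⟩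
  have key := indAll_eq_sum K hε d
  rw [← Finset.add_sum_erase _ _ hm₁, ← Finset.add_sum_erase _ _ hm₂] at key
  simp only [indTorsionFree_zero, indTorsion_zero, mul_one, one_mul, ← add_assoc] at key
  have hrest : ∑ p ∈ ((splittings d).erase (d, 0)).erase (0, d),
      ε ^ twist p.1 p.2 • (indTorsionFree K ε p.1 * indTorsion K ε p.2) ∈ S := by
    refine S.sum_mem fun p hp => hS _ _ ?_
    simp only [Finset.mem_erase, mem_splittings] at hp
    obtain ⟨h₁, h₂, h₃⟩ := hp
    obtain ⟨⟨b₀, b₁⟩, ⟨c₀, c₁⟩⟩ := p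
    obtain ⟨d₀, d₁⟩ := d
    simp only [Prod.mk_add_mk, Prod.mk.injEq, ne_eq, Prod.zero_eq_mk] at *
    exact S.mul_mem (ih _ (by simp only; omega) (b₀, b₁) rfl).1
      (ih _ (by simp only; omega) (c₀, c₁) rfl).2
  have hsum : indTorsionFree K ε d + indTorsion K ε d ∈ S := by
    have h := S.sub_mem (hA d) hrest
    rw [key, add_sub_cancel_right] at h
    simpa [twist] using h
  -- The sign of the defect of `d` makes one summand zero, so the sum isolates the other.
  rcases le_or_gt d.1 d.2 with h | h
  · rw [indTorsion_eq_zero K ε hd h, add_zero] at hsum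
    rw [indTorsion_eq_zero K ε hd h]
    exact ⟨hsum, S.zero_mem⟩
  · rw [indTorsionFree_eq_zero K ε h, zero_add] at hsum
    rw [indTorsionFree_eq_zero K ε h]
    exact ⟨S.zero_mem, hsum⟩

end Indicator

/-! ### Divided powers of the generators -/

section DividedPowers

/-! ### Counting simple subrepresentations -/

section Lines

variable {K : Type*} [Field K] [Finite K]
variable {V₀ V₁ : Type*} [AddCommGroup V₀] [Module K V₀] [AddCommGroup V₁] [Module K V₁]

theorem card_lines (V : Type*) [AddCommGroup V] [Module K V] {n : ℕ}
    (h : Module.finrank K V = n) :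
    Nat.card {H : Submodule K V // Module.finrank K H = 1} =
      ∑ i ∈ Finset.range n, Nat.card K ^ i := by
  rw [← Projectivization.card_of_finrank K V h]
  exact Nat.card_congr (Projectivization.equivSubmodule K V).symm

theorem card_subrep_of_snd_eq_zero [Finite V₁] (x : Rep K V₀ V₁) {n : ℕ} (h : dim x = (n, 0)) :
    Nat.card {W : Subrep x // dim W.sub = (1, 0)} = ∑ i ∈ Finset.range n, Nat.card K ^ i := by
  obtain ⟨h₀, h₁⟩ := Prod.mk.inj h
  have : Subsingleton V₁ := Module.finrank_zero_iff.1 h₁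
  rw [← card_lines V₀ h₀]
  refine Nat.card_congr ⟨fun W => ⟨W.1.W₀, congrArg Prod.fst W.2⟩,
    fun H => ⟨⟨H.1, ⊥, fun a v _ => Subsingleton.elim _ _⟩, Prod.ext H.2 (finrank_bot K V₁)⟩,
    fun W => Subtype.ext (Subrep.ext rfl (Subsingleton.elim _ _)), fun H => rfl⟩

theorem card_subrep_of_fst_eq_zero [Finite V₀] (x : Rep K V₀ V₁) {n : ℕ} (h : dim x = (0, n)) :
    Nat.card {W : Subrep x // dim W.sub = (0, 1)} = ∑ i ∈ Finset.range n, Nat.card K ^ i := by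
  obtain ⟨h₀, h₁⟩ := Prod.mk.inj h
  have : Subsingleton V₀ := Module.finrank_zero_iff.1 h₀
  rw [← card_lines V₁ h₁]
  refine Nat.card_congr ⟨fun W => ⟨W.1.W₁, congrArg Prod.snd W.2⟩,
    fun H => ⟨⟨⊥, H.1, fun a v hv => ?_⟩, Prod.ext (finrank_bot K V₀) H.2⟩,
    fun W => Subtype.ext (Subrep.ext (Subsingleton.elim _ _) rfl), fun H => rfl⟩
  rw [(Submodule.mem_bot K).1 hv]
  exact Submodule.zero_mem _

end Lines

variable (K : Type*) [Field K] {R : Type*} [Field R] {ε : R}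

/-- The dimension vector of the simple representation at the vertex `i`. -/
def simpleDim (i : ZMod 2) : ℕ × ℕ := if i = 0 then (1, 0) else (0, 1)

theorem theta_eq_indAll (i : ZMod 2) : theta K ε i = indAll K ε (simpleDim i) := rfl

variable [Finite K]

variable {K} in
theorem card_subrep_simpleDim {V₀ V₁ : Type*} [AddCommGroup V₀] [Module K V₀] [AddCommGroup V₁]
    [Module K V₁] [Finite V₀] [Finite V₁] (x : Rep K V₀ V₁) (i : ZMod 2) {n : ℕ}
    (h : dim x = n • simpleDim i) :
    Nat.card {W : Subrep x // dim W.sub = simpleDim i} =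
      ∑ i ∈ Finset.range n, Nat.card K ^ i := by
  unfold simpleDim at h ⊢
  split_ifs at h ⊢
  · exact card_subrep_of_snd_eq_zero x (by simpa using h)
  · exact card_subrep_of_fst_eq_zero x (by simpa using h)

theorem twist_smul_simpleDim (i : ZMod 2) (n : ℕ) :
    twist (n • simpleDim i) (simpleDim i) = n := by
  unfold simpleDim
  split_ifs <;> simp [twist]

section

variable [CharZero R]

theorem epsilon_ne_zero (hε : ε ^ 2 = (Nat.card K : R)) : ε ≠ 0 := by
  rintro rfl
  have : (Nat.card K : R) ≠ 0 := Nat.cast_ne_zero.2 Nat.card_pos.ne'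
  simp [← hε] at this

theorem epsilon_pow_sq_ne_one (hε : ε ^ 2 = (Nat.card K : R)) {n : ℕ} (hn : n ≠ 0) :
    (ε ^ 2) ^ n ≠ 1 := by
  rw [hε, ← Nat.cast_pow, Nat.cast_ne_one]
  exact (Nat.one_lt_pow hn Finite.one_lt_card).ne'

theorem epsilon_pow_sub_inv_ne_zero (hε : ε ^ 2 = (Nat.card K : R)) {n : ℕ} (hn : n ≠ 0) :
    ε ^ n - ε⁻¹ ^ n ≠ 0 := by
  have h0 := epsilon_ne_zero K hε
  intro h
  refine epsilon_pow_sq_ne_one K hε hn ?_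
  rw [← pow_mul, mul_comm, pow_mul, sq]
  nth_rewrite 2 [sub_eq_zero.1 h]
  rw [← mul_pow, mul_inv_cancel₀ h0, one_pow]

theorem qInt_ne_zero (hε : ε ^ 2 = (Nat.card K : R)) {n : ℕ} (hn : n ≠ 0) : qInt ε n ≠ 0 :=
  div_ne_zero (epsilon_pow_sub_inv_ne_zero K hε hn)
    (by simpa using epsilon_pow_sub_inv_ne_zero K hε one_ne_zero)

theorem qFactorial_ne_zero (hε : ε ^ 2 = (Nat.card K : R)) (n : ℕ) : qFactorial ε n ≠ 0 :=
  Finset.prod_ne_zero_iff.2 fun j _ => qInt_ne_zero K hε j.succ_ne_zero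

theorem inv_pow_mul_geom_sum (hε : ε ^ 2 = (Nat.card K : R)) (n : ℕ) :
    ε⁻¹ ^ n * ((∑ i ∈ Finset.range (n + 1), Nat.card K ^ i : ℕ) : R) = qInt ε (n + 1) := by
  have h0 := epsilon_ne_zero K hε
  have h1 : ε ^ 2 - 1 ≠ 0 := sub_ne_zero.2 (by simpa using epsilon_pow_sq_ne_one K hε one_ne_zero)
  have h2 : ε - ε⁻¹ ≠ 0 := by simpa using epsilon_pow_sub_inv_ne_zero K hε one_ne_zero
  have h3 := geom_sum_mul (ε ^ 2) (n + 1)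
  rw [qInt, eq_div_iff h2]
  push_cast
  rw [← hε]
  refine mul_right_cancel₀ (mul_ne_zero h0 (pow_ne_zero n h0)) ?_
  have h4 : ε⁻¹ * ε = 1 := inv_mul_cancel₀ h0
  have h5 : ε⁻¹ ^ n * ε ^ n = 1 := by rw [← mul_pow, h4, one_pow]
  calc _ = (ε⁻¹ ^ n * ε ^ n) * ((∑ i ∈ Finset.range (n + 1), (ε ^ 2) ^ i) *
        (ε ^ 2 - ε⁻¹ * ε)) := by ring
    _ = (ε ^ 2) ^ (n + 1) - 1 := by rw [h4, h5, h3, one_mul]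
    _ = (ε ^ 2) ^ (n + 1) - (ε⁻¹ ^ n * ε ^ n) * (ε⁻¹ * ε) := by rw [h4, h5, one_mul]
    _ = _ := by ring

/-- The product counts the lines in `K^(n+1)`, each weighted by `ε⁻¹ ^ n`; this symmetrizes `1 + q +
⋯ + q^n` into a quantum integer. -/
theorem indAll_mul_theta (hε : ε ^ 2 = (Nat.card K : R)) (i : ZMod 2) (n : ℕ) :
    indAll K ε (n • simpleDim i) * theta K ε i =
      qInt ε (n + 1) • indAll K ε ((n + 1) • simpleDim i) := by
  classical
  ext e x
  have hterm : ∀ W : Subrep x, HallAlgebra.term (indAll K ε (n • simpleDim i)) (theta K ε i) W =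
      if dim x = (n + 1) • simpleDim i then
        if dim W.sub = simpleDim i then ε⁻¹ ^ n else 0 else 0 := by
    intro W
    rw [HallAlgebra.term, theta_eq_indAll, val_indAll, val_indAll, dim_eq_add W]
    by_cases h : dim W.sub = simpleDim i
    · simp only [h, succ_nsmul, add_left_inj]
      by_cases h' : dim W.quot = n • simpleDim i
      · simp only [h', twist_smul_simpleDim, if_true, mul_one]
      · simp only [h', if_false, zero_mul, mul_zero]
    · simp [h]
  simp only [HallAlgebra.fn_mul, hterm, HallAlgebra.fn_smul]
  change _ = _ * (if e = (n + 1) • simpleDim i then 1 else 0)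
  rw [dim_E]
  split_ifs with h
  · have hc := card_subrep_simpleDim x i ((dim_E x).trans h)
    rw [← inv_pow_mul_geom_sum K hε, ← hc, Finset.sum_ite, Finset.sum_const_zero, add_zero,
      Finset.sum_const, Nat.card_eq_fintype_card, Fintype.card_subtype, nsmul_eq_mul, mul_one,
      mul_comm]
  · simp

theorem theta_pow (hε : ε ^ 2 = (Nat.card K : R)) (i : ZMod 2) (n : ℕ) :
    theta K ε i ^ n = qFactorial ε n • indAll K ε (n • simpleDim i) := by
  induction n with
  | zero =>
    rw [pow_zero, zero_smul, qFactorial, Finset.prod_range_zero, one_smul]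
    rfl
  | succ n ih =>
    rw [pow_succ, ih, smul_mul_assoc, indAll_mul_theta K hε, smul_smul, qFactorial, qFactorial,
      Finset.prod_range_succ]

theorem thetaDiv_eq_indAll (hε : ε ^ 2 = (Nat.card K : R)) (i : ZMod 2) (n : ℕ) :
    thetaDiv K ε i n = indAll K ε (n • simpleDim i) := by
  rw [thetaDiv, theta_pow K hε, smul_smul, inv_mul_cancel₀ (qFactorial_ne_zero K hε n), one_smul]

/-- Only `W = (0, V₁)` has the required dimensions, and it is always stable because both arrows end
at vertex `1`. So every point has the same value. -/
theorem indAll_eq_thetaDiv_mul_thetaDiv (hε : ε ^ 2 = (Nat.card K : R)) (d : ℕ × ℕ) :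
    indAll K ε d = ε ^ twist (d.1, 0) (0, d.2) • (thetaDiv K ε 0 d.1 * thetaDiv K ε 1 d.2) := by
  classical
  have h0 := epsilon_ne_zero K hε
  have e0 : d.1 • simpleDim 0 = (d.1, 0) := by simp [simpleDim]
  have e1 : d.2 • simpleDim 1 = (0, d.2) := by simp [simpleDim]
  rw [thetaDiv_eq_indAll K hε, thetaDiv_eq_indAll K hε, e0, e1]
  ext e x
  let W₀ : Subrep x := ⟨⊥, ⊤, fun _ _ _ => trivial⟩
  have hterm : ∀ W : Subrep x, ε ^ twist (d.1, 0) (0, d.2) *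
      HallAlgebra.term (indAll K ε (d.1, 0)) (indAll K ε (0, d.2)) W =
      if dim W.quot = (d.1, 0) ∧ dim W.sub = (0, d.2) then 1 else 0 := by
    intro W
    rw [HallAlgebra.term, val_indAll, val_indAll]
    by_cases h₁ : dim W.quot = (d.1, 0)
    · by_cases h₂ : dim W.sub = (0, d.2)
      · simp [h₁, h₂, h0]
      · simp [h₂]
    · simp [h₁]
  have hW : ∀ W : Subrep x, dim W.quot = (d.1, 0) ∧ dim W.sub = (0, d.2) → W = W₀ := by
    rintro W ⟨h₁, h₂⟩
    refine Subrep.ext ?_ ?_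
    · exact Submodule.finrank_eq_zero.1 (congrArg Prod.fst h₂)
    · exact Submodule.Quotient.subsingleton_iff.1
        (Module.finrank_zero_iff.1 (congrArg Prod.snd h₁))
  have hW₀ : (dim W₀.quot = (d.1, 0) ∧ dim W₀.sub = (0, d.2)) ↔ e = d := by
    have h₁ : dim W₀.quot = (e.1, 0) := by
      refine Prod.ext ?_ ?_
      · exact (Submodule.quotEquivOfEqBot (⊥ : Submodule K (Fin e.1 → K)) rfl).finrank_eq.trans
          (by simp)
      · exact Module.finrank_zero_iff.2 (Submodule.Quotient.subsingleton_iff.2 rfl)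
    have h₂ : dim W₀.sub = (0, e.2) :=
      Prod.ext (finrank_bot K _) ((finrank_top K _).trans (by simp))
    rw [h₁, h₂]
    simp [Prod.ext_iff]
  simp only [HallAlgebra.fn_smul, HallAlgebra.fn_mul, Finset.mul_sum, hterm]
  rw [Finset.sum_eq_single W₀]
  · exact if_congr hW₀.symm rfl rfl
  · exact fun W _ h => if_neg fun h' => h (hW W h')
  · simp

end

end DividedPowers

/-! ### Membership in the composition algebra -/

section Composition

variable (K : Type*) [Field K] [Finite K] {R : Type*} [Field R] {ε : R}

theorem pow_smul_mem_compositionAlgebra (n : ℕ) {f : HallAlgebra K R ε}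
    (hf : f ∈ compositionAlgebra K ε) : ε ^ n • f ∈ compositionAlgebra K ε := by
  have h : ε ^ n ∈ laurent ε := pow_mem (Algebra.subset_adjoin (by simp)) n
  exact (compositionAlgebra K ε).smul_mem hf (⟨ε ^ n, h⟩ : laurent ε)

theorem inv_pow_smul_mem_compositionAlgebra (n : ℕ) {f : HallAlgebra K R ε}
    (hf : f ∈ compositionAlgebra K ε) : ε⁻¹ ^ n • f ∈ compositionAlgebra K ε := by
  have h : ε⁻¹ ^ n ∈ laurent ε := pow_mem (Algebra.subset_adjoin (by simp)) n
  exact (compositionAlgebra K ε).smul_mem hf (⟨ε⁻¹ ^ n, h⟩ : laurent ε)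

theorem thetaDiv_mem_compositionAlgebra (i : ZMod 2) (n : ℕ) :
    thetaDiv K ε i n ∈ compositionAlgebra K ε :=
  Algebra.subset_adjoin ⟨i, n, rfl⟩

theorem indTorsionFree_mem_compositionAlgebra [CharZero R] (hε : ε ^ 2 = (Nat.card K : R))
    (d : ℕ × ℕ) : indTorsionFree K ε d ∈ compositionAlgebra K ε := by
  refine (indTorsion_mem_of_indAll_mem K (epsilon_ne_zero K hε)
    (compositionAlgebra K ε).toSubring
    (fun n f hf => pow_smul_mem_compositionAlgebra K n hf) (fun d => ?_) d).1
  rw [indAll_eq_thetaDiv_mul_thetaDiv K hε]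
  exact pow_smul_mem_compositionAlgebra K _
    (mul_mem (thetaDiv_mem_compositionAlgebra K _ _) (thetaDiv_mem_compositionAlgebra K _ _))

theorem mem_adjoin_theta_of_mem_compositionAlgebra {f : HallAlgebra K R ε}
    (hf : f ∈ compositionAlgebra K ε) :
    f ∈ Algebra.adjoin R ({theta K ε 0, theta K ε 1} : Set (HallAlgebra K R ε)) := by
  induction hf using Algebra.adjoin_induction with
  | mem f hf =>
    obtain ⟨i, n, rfl⟩ := hf
    refine Subalgebra.smul_mem _ (pow_mem (Algebra.subset_adjoin ?_) n) _
    fin_cases i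
    · exact Or.inl rfl
    · exact Or.inr rfl
  | algebraMap r => exact Subalgebra.algebraMap_mem _ (r : R)
  | add f g _ _ hf hg => exact add_mem hf hg
  | mul f g _ _ hf hg => exact mul_mem hf hg

end Composition

/-! ### Regular representations and invertible members of the pencil -/

section Pencil

open Polynomial

variable {k : Type*} [Field k]
variable {V₀ V₁ : Type*} [AddCommGroup V₀] [Module k V₀] [AddCommGroup V₁] [Module k V₁]

/-- Each block degenerates at a single point of the projective line, and finitely many points can be
avoided. -/
theorem exists_bijective_of_isRegularRep [Infinite k] {z : Rep k V₀ V₁} (h : IsRegularRep z) :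
    ∃ t : k, Function.Bijective (z 0 + t • z 1) := by
  classical
  obtain ⟨r, n, y, hy, e₀, e₁, he⟩ := h
  choose l₀ m₀ hne hbij hker using hy
  -- If `l₀ j = 0` the bad point is at infinity and no `t` is bad; the default quotient `0` is then
  -- excluded harmlessly.
  obtain ⟨t, ht⟩ := Infinite.exists_notMem_finset (Finset.univ.image fun j => m₀ j / l₀ j)
  have hb : ∀ j, Function.Bijective (y j 0 + t • y j 1) := by
    intro j
    have := hbij j 1 t fun h => by
      by_cases hl : l₀ j = 0
      · exact hne j (by simp_all)
      · exact ht (Finset.mem_image.2 ⟨j, Finset.mem_univ j, by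
          rw [div_eq_iff hl, ← h, one_mul]⟩)
    rwa [one_smul] at this
  refine ⟨t, ?_⟩
  have hD : Function.Bijective (directSum y 0 + t • directSum y 1) :=
    Function.Bijective.piMap hb
  have hcomp : ⇑e₁ ∘ ⇑(z 0 + t • z 1) = ⇑(directSum y 0 + t • directSum y 1) ∘ ⇑e₀ := by
    ext1 v
    simp [he]
  rw [← Function.Bijective.of_comp_iff' e₁.bijective, hcomp]
  exact hD.comp e₀.bijective

/-! ### Jordan blocks and the decomposition of invertible pencils -/

/-- Coordinate-free form of `IsRegularIndecomposable`. -/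
def IsRegularBlock (z : Rep k V₀ V₁) : Prop :=
  ∃ l₀ m₀ : k, (l₀, m₀) ≠ (0, 0) ∧
    (∀ l m : k, l * m₀ ≠ m * l₀ → Function.Bijective (l • z 0 + m • z 1)) ∧
    Module.finrank k (LinearMap.ker (l₀ • z 0 + m₀ • z 1)) = 1

theorem IsRegularBlock.conj {z : Rep k V₀ V₀} (h : IsRegularBlock z) {n : ℕ}
    (e : V₀ ≃ₗ[k] (Fin n → k)) :
    IsRegularIndecomposable (fun a => e.conj (z a) : Rep k (Fin n → k) (Fin n → k)) := by
  obtain ⟨l₀, m₀, hne, hbij, hker⟩ := h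
  refine ⟨l₀, m₀, hne, fun l m hlm => ?_, ?_⟩
  · rw [← map_smul, ← map_smul, ← map_add, LinearEquiv.conj_apply]
    exact e.bijective.comp ((hbij l m hlm).comp e.symm.bijective)
  · rw [← map_smul, ← map_smul, ← map_add, LinearEquiv.conj_apply, ← hker,
      LinearMap.ker_comp, LinearEquiv.ker_comp, Submodule.comap_equiv_eq_map_symm]
    exact LinearEquiv.finrank_map_eq _ _

/-- Zero summands are allowed because a primary decomposition may contain trivial factors; they are
not regular indecomposable and have to be dropped from the index set. -/
theorem isRegularRep_pi {ι : Type*} [Finite ι] {M : ι → Type*} [∀ i, AddCommGroup (M i)]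
    [∀ i, Module k (M i)] [∀ i, FiniteDimensional k (M i)] (z : ∀ i, Rep k (M i) (M i))
    (hz : ∀ i, Subsingleton (M i) ∨ IsRegularBlock (z i)) :
    IsRegularRep (fun a => LinearMap.pi fun i => z i a ∘ₗ LinearMap.proj i :
      Rep k (∀ i, M i) (∀ i, M i)) := by
  classical
  let J := {i // ¬ Subsingleton (M i)}
  have : Fintype J := Fintype.ofFinite J
  let σ : Fin (Fintype.card J) ≃ J := (Fintype.equivFin J).symm
  let e : ∀ i, M i ≃ₗ[k] (Fin (Module.finrank k (M i)) → k) := fun i =>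
    (Module.finBasis k (M i)).equivFun
  let φ : (∀ i, M i) →ₗ[k] ∀ j, Fin (Module.finrank k (M (σ j))) → k :=
    LinearMap.pi fun j => (e (σ j)).toLinearMap ∘ₗ LinearMap.proj (σ j).1
  have hφ : Function.Bijective φ := by
    constructor
    · intro v w h
      ext i
      by_cases hi : Subsingleton (M i)
      · exact Subsingleton.elim _ _
      · obtain ⟨j, hj⟩ := σ.surjective ⟨i, hi⟩
        have h' : v (σ j).1 = w (σ j).1 := (e (σ j)).injective (congrFun h j)
        rwa [hj] at h'
    · intro w
      let w' := Equiv.piCongrLeft (fun i : J => Fin (Module.finrank k (M i)) → k) σ w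
      refine ⟨fun i => if h : ¬ Subsingleton (M i) then (e i).symm (w' ⟨i, h⟩) else 0, ?_⟩
      ext1 j
      have h₁ : φ (fun i => if h : ¬ Subsingleton (M i) then (e i).symm (w' ⟨i, h⟩) else 0) j =
          w' (σ j) := by
        change e (σ j).1 (dite _ _ _) = _
        rw [dif_pos (σ j).2, LinearEquiv.apply_symm_apply]
      rw [h₁]
      exact Equiv.piCongrLeft_apply_apply _ _ _ _
  let Φ := LinearEquiv.ofBijective φ hφ
  refine ⟨_, fun j => Module.finrank k (M (σ j)), fun j a => (e (σ j)).conj (z (σ j) a),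
    fun j => ((hz (σ j)).resolve_left (σ j).2).conj _, Φ, Φ, fun a v => ?_⟩
  ext1 j
  change e (σ j) (z (σ j) a (v (σ j))) =
    e (σ j) (z (σ j) a ((e (σ j)).symm (e (σ j) (v (σ j)))))
  rw [LinearEquiv.symm_apply_apply]

/-- The pencil acts as multiplication by `l + (m - l t) X`, which is invertible modulo `p ^ e` as
soon as it does not vanish at the root `c` of `p`. -/
theorem isRegularBlock_quotient [IsAlgClosed k] {p : k[X]} (hp : Irreducible p) {e : ℕ}
    (he : e ≠ 0) (t : k) (N : (k[X] ⧸ Ideal.span {p ^ e}) →ₗ[k] k[X] ⧸ Ideal.span {p ^ e})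
    (hN : ∀ v, N v = (X : k[X]) • v) :
    IsRegularBlock (![1 - t • N, N] : Rep k (k[X] ⧸ Ideal.span {p ^ e}) _) := by
  have hC : ∀ (a : k) (v : k[X] ⧸ Ideal.span {p ^ e}), C a • v = a • v := fun a v =>
    algebraMap_smul k[X] a v
  have hlin : ∀ (l m : k) v, (l • (1 - t • N) + m • N) v = (C l + C (m - l * t) * X) • v := by
    intro l m v
    rw [add_smul, mul_smul, hC, hC, ← hN, LinearMap.add_apply, LinearMap.smul_apply,
      LinearMap.smul_apply, LinearMap.sub_apply, LinearMap.smul_apply, Module.End.one_apply]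
    module
  obtain ⟨c, hc⟩ := IsAlgClosed.exists_root p
    (by rw [IsAlgClosed.degree_eq_one_of_irreducible k hp]; exact one_ne_zero)
  -- At this point of the pencil the multiplier is `c - X`, a generator of the maximal ideal up to
  -- sign.
  refine ⟨c, c * t - 1, ?_, ?_, ?_⟩
  · intro h
    obtain ⟨h₁, h₂⟩ := Prod.mk.inj h
    simp [h₁] at h₂
  · intro l m hlm
    have hcop : IsCoprime (p ^ e) (C l + C (m - l * t) * X) := by
      refine IsCoprime.pow_left (hp.coprime_iff_not_dvd.2 fun hdvd => ?_)
      have := hc.dvd hdvd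
      simp only [IsRoot.def, eval_add, eval_mul, eval_C, eval_X] at this
      exact hlm (by linear_combination -this)
    obtain ⟨a, b, hab⟩ := hcop
    have hz : ∀ v : k[X] ⧸ Ideal.span {p ^ e}, (b * (C l + C (m - l * t) * X)) • v = v := by
      intro v
      obtain ⟨f, rfl⟩ := Ideal.Quotient.mk_surjective v
      refine Ideal.Quotient.eq.2 (Ideal.mem_span_singleton.2 ⟨-(a * f), ?_⟩)
      change b * (C l + C (m - l * t) * X) * f - f = _
      linear_combination f * hab
    refine Function.bijective_iff_has_inverse.2 ⟨fun v => b • v, fun v => ?_, fun v => ?_⟩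
    · exact (congrArg (b • ·) (hlin l m v)).trans ((mul_smul _ _ _).symm.trans (hz v))
    · exact (hlin l m _).trans ((mul_smul _ _ _).symm.trans ((mul_comm b _) ▸ hz v))
  · have hfin : Module.Finite k (k[X] ⧸ Ideal.span {p ^ e}) :=
      (AdjoinRoot.powerBasis (pow_ne_zero e hp.ne_zero)).finite
    -- Evaluation at `c` identifies the cokernel of multiplication by `c - X` with `k`; by
    -- rank-nullity the kernel is one-dimensional too.
    let φ : (k[X] ⧸ Ideal.span {p ^ e}) →ₗ[k] k :=
      (Ideal.Quotient.liftₐ (Ideal.span {p ^ e}) (aeval c) (fun f hf => by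
        obtain ⟨g, rfl⟩ := Ideal.mem_span_singleton.1 hf
        rw [map_mul, map_pow, coe_aeval_eq_eval, hc.eq_zero, zero_pow he,
          zero_mul])).toLinearMap
    have hφ : ∀ f, φ (Ideal.Quotient.mk _ f) = eval c f := fun f => rfl
    have hT : ∀ f : k[X], (c • (1 - t • N) + (c * t - 1) • N) (Ideal.Quotient.mk _ f) =
        Ideal.Quotient.mk _ ((C c - X) * f) := by
      intro f
      rw [hlin, sub_sub_cancel_left, C_neg, C_1, neg_one_mul, ← sub_eq_add_neg]
      rfl
    have hker : LinearMap.ker φ = LinearMap.range (c • (1 - t • N) + (c * t - 1) • N) := by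
      refine le_antisymm (fun v hv => ?_) ?_
      · obtain ⟨f, rfl⟩ := Ideal.Quotient.mk_surjective v
        obtain ⟨g, rfl⟩ := dvd_iff_isRoot.2 (hφ f ▸ LinearMap.mem_ker.1 hv)
        refine ⟨Ideal.Quotient.mk _ (-g), ?_⟩
        rw [hT]
        congr 1
        ring
      · rintro _ ⟨v, rfl⟩
        obtain ⟨f, rfl⟩ := Ideal.Quotient.mk_surjective v
        rw [LinearMap.mem_ker, hT, hφ, eval_mul, eval_sub, eval_C, eval_X, sub_self, zero_mul]
    have hrange : LinearMap.range φ = ⊤ :=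
      LinearMap.range_eq_top.2 fun a => ⟨Ideal.Quotient.mk _ (C a), by rw [hφ, eval_C]⟩
    have h₁ := LinearMap.finrank_range_add_finrank_ker φ
    have h₂ := LinearMap.finrank_range_add_finrank_ker (c • (1 - t • N) + (c * t - 1) • N)
    rw [hrange, finrank_top, Module.finrank_self, hker] at h₁
    change Module.finrank k (LinearMap.ker (c • (1 - t • N) + (c * t - 1) • N)) = 1
    exact Nat.add_left_cancel (h₂.trans (h₁.symm.trans (add_comm _ _)))

/-- `N` makes `V₀` a finitely generated torsion `k[X]`-module, hence a sum of cyclic primary ones,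
each of which is zero or a regular block. -/
theorem isRegularRep_of_endomorphism [IsAlgClosed k] [FiniteDimensional k V₀] (t : k)
    (N : V₀ →ₗ[k] V₀) : IsRegularRep (![1 - t • N, N] : Rep k V₀ V₀) := by
  classical
  obtain ⟨ι, _, p, hp, e, ⟨Φ⟩⟩ := Module.equiv_directSum_of_isTorsion
    (Module.AEval.isTorsion_of_finiteDimensional k V₀ N)
  let Ψ := Φ.trans (DirectSum.linearEquivFunOnFintype k[X] ι fun i => k[X] ⧸ Ideal.span {p i ^ e i})
  let Θ : V₀ ≃ₗ[k] ∀ i, k[X] ⧸ Ideal.span {p i ^ e i} :=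
    (Module.AEval'.of N).trans (Ψ.restrictScalars k)
  have hΘ : ∀ v i, Θ (N v) i = (X : k[X]) • Θ v i := by
    intro v i
    change Ψ (Module.AEval'.of N (N v)) i = (X : k[X]) • Ψ (Module.AEval'.of N v) i
    rw [← Module.AEval'.X_smul_of, map_smul]
    rfl
  have hfin : ∀ i, Module.Finite k (k[X] ⧸ Ideal.span {p i ^ e i}) := fun i =>
    (AdjoinRoot.powerBasis (pow_ne_zero (e i) (hp i).ne_zero)).finite
  let N' : ∀ i, (k[X] ⧸ Ideal.span {p i ^ e i}) →ₗ[k] k[X] ⧸ Ideal.span {p i ^ e i} := fun i =>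
    (LinearMap.lsmul k[X] _ (X : k[X])).restrictScalars k
  obtain ⟨r, n, y, hy, hiso⟩ := isRegularRep_pi (k := k)
    (fun i => (![1 - t • N' i, N' i] : Rep k (k[X] ⧸ Ideal.span {p i ^ e i}) _)) (fun i => by
      by_cases he : e i = 0
      · left
        rw [he, pow_zero, Ideal.span_singleton_one]
        exact Submodule.Quotient.subsingleton_iff.2 rfl
      · exact Or.inr (isRegularBlock_quotient (hp i) he t _ fun _ => rfl))
  refine ⟨r, n, y, hy, Iso.trans ⟨Θ, Θ, fun a v => ?_⟩ hiso⟩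
  ext1 i
  fin_cases a
  · change Θ (v - t • N v) i = Θ v i - t • ((X : k[X]) • Θ v i)
    rw [map_sub, map_smul, ← hΘ]
    rfl
  · exact hΘ v i

/-- Identifying `V₁` with `V₀` through the invertible member `z 0 + t • z 1` turns `z 1` into an
endomorphism `N` and `z 0` into `1 - t • N`. -/
theorem isRegularRep_of_bijective [IsAlgClosed k] [FiniteDimensional k V₀] {z : Rep k V₀ V₁}
    {t : k} (h : Function.Bijective (z 0 + t • z 1)) : IsRegularRep z := by
  let y := LinearEquiv.ofBijective _ h
  have hy : ∀ v, y v = z 0 v + t • z 1 v := fun v => rfl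
  obtain ⟨r, n, b, hb, hiso⟩ := isRegularRep_of_endomorphism t (y.symm.toLinearMap ∘ₗ z 1)
  refine ⟨r, n, b, hb, Iso.trans ⟨LinearEquiv.refl k V₀, y.symm, fun a v => ?_⟩ hiso⟩
  fin_cases a
  · change y.symm (z 0 v) = v - t • y.symm (z 1 v)
    rw [LinearEquiv.symm_apply_eq, map_sub, map_smul, LinearEquiv.apply_symm_apply, hy]
    simp
  · rfl

end Pencil

/-! ### Regularity and the torsion pair -/

section Geometric

open Polynomial

variable {K : Type*} [Field K]

/-- The injective pencil member restricts to an injection from the extension of `W₀` into that of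
`W₁`, and dimensions survive scalar extension. -/
theorem isTorsionFree_of_injective {V₀ V₁ : Type*} [AddCommGroup V₀] [Module K V₀]
    [AddCommGroup V₁] [Module K V₁] [FiniteDimensional K V₀] [FiniteDimensional K V₁]
    {x : Rep K V₀ V₁} {t : AlgebraicClosure K}
    (h : Function.Injective (geom x 0 + t • geom x 1)) : IsTorsionFree x := by
  intro W
  let i₀ := W.W₀.subtype.baseChange (AlgebraicClosure K)
  let i₁ := W.W₁.subtype.baseChange (AlgebraicClosure K)
  have h₀ : Function.Injective i₀ :=
    Module.Flat.lTensor_preserves_injective_linearMap _ W.W₀.injective_subtype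
  have hc : ∀ a, i₁ ∘ₗ geom W.sub a = geom x a ∘ₗ i₀ := by
    intro a
    rw [geom, geom, ← LinearMap.baseChange_comp, ← LinearMap.baseChange_comp]
    rfl
  have hg : Function.Injective (geom W.sub 0 + t • geom W.sub 1) := by
    refine Function.Injective.of_comp (f := i₁) ?_
    have : i₁ ∘ₗ (geom W.sub 0 + t • geom W.sub 1) = (geom x 0 + t • geom x 1) ∘ₗ i₀ := by
      rw [LinearMap.comp_add, LinearMap.comp_smul, hc, hc, LinearMap.add_comp,
        LinearMap.smul_comp]
    rw [← LinearMap.coe_comp, this, LinearMap.coe_comp]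
    exact h.comp h₀
  have := LinearMap.finrank_le_finrank_of_injective hg
  rwa [Module.finrank_baseChange, Module.finrank_baseChange] at this

/-- The recursion makes both arrows map the span `U` of the sequence into `x 0 (U)`. Since `x 0`
kills the first nonzero term, that image is smaller than `U`. -/
theorem not_isTorsionFree_of_sequence {V₀ V₁ : Type*} [AddCommGroup V₀] [Module K V₀]
    [AddCommGroup V₁] [Module K V₁] [FiniteDimensional K V₀]
    {x : Rep K V₀ V₁} (u : ℕ → V₀) (hu : ∃ n, u n ≠ 0) (h0 : x 0 (u 0) = 0)
    (hs : ∀ n, x 0 (u (n + 1)) + x 1 (u n) = 0) : ¬ IsTorsionFree x := by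
  classical
  intro h
  let U := Submodule.span K (Set.range u)
  have hU : ∀ n, u n ∈ U := fun n => Submodule.subset_span ⟨n, rfl⟩
  let W : Subrep x := ⟨U, U.map (x 0), fun a => by
    fin_cases a
    · exact Submodule.le_comap_map _ _
    · refine Submodule.span_le.2 ?_
      rintro _ ⟨n, rfl⟩
      refine ⟨-u (n + 1), U.neg_mem (hU _), ?_⟩
      rw [map_neg]
      exact neg_eq_of_add_eq_zero_right (hs n)⟩
  have hW : Module.finrank K U ≤ Module.finrank K (U.map (x 0)) := h W
  have hrk := LinearMap.finrank_range_add_finrank_ker ((x 0).domRestrict U)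
  rw [LinearMap.range_domRestrict] at hrk
  have hker : LinearMap.ker ((x 0).domRestrict U) = ⊥ :=
    Submodule.finrank_eq_zero.1 (by omega)
  have hn := Nat.find_spec hu
  have hz : x 0 (u (Nat.find hu)) = 0 := by
    rcases hm : Nat.find hu with _ | m
    · exact h0
    · have := hs m
      rwa [not_not.1 (Nat.find_min hu (hm ▸ m.lt_succ_self : m < Nat.find hu)), map_zero,
        add_zero] at this
  have : (⟨u (Nat.find hu), hU _⟩ : U) ∈ LinearMap.ker ((x 0).domRestrict U) := hz
  rw [hker, Submodule.mem_bot] at this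
  exact hn (congrArg Subtype.val this)

/-- The matrix of the pencil `x 0 + t x 1`, with polynomial entries. -/
def pencilMatrix {d : ℕ} (x : Rep K (Fin d → K) (Fin d → K)) : Matrix (Fin d) (Fin d) K[X] :=
  (LinearMap.toMatrix' (x 0)).map C + (X : K[X]) • (LinearMap.toMatrix' (x 1)).map C

/-- A zero determinant gives a polynomial kernel vector; comparing powers of `X` shows that its
coefficients form a sequence as in `not_isTorsionFree_of_sequence`. -/
theorem det_pencilMatrix_ne_zero {d : ℕ} {x : Rep K (Fin d → K) (Fin d → K)}
    (h : IsTorsionFree x) : (pencilMatrix x).det ≠ 0 := by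
  intro hdet
  obtain ⟨v, hv, hMv⟩ := Matrix.exists_mulVec_eq_zero_iff.2 hdet
  have hco : ∀ (A : Matrix (Fin d) (Fin d) K) (n : ℕ) (i : Fin d),
      ((A.map C).mulVec v i).coeff n = A.mulVec (fun j => (v j).coeff n) i := by
    intro A n i
    simp [Matrix.mulVec, dotProduct]
  have happ : ∀ a (w : Fin d → K), x a w = (LinearMap.toMatrix' (x a)).mulVec w := by
    intro a w
    rw [← Matrix.toLin'_apply, Matrix.toLin'_toMatrix']
  have hi : ∀ i, ((LinearMap.toMatrix' (x 0)).map C).mulVec v i +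
      X * ((LinearMap.toMatrix' (x 1)).map C).mulVec v i = 0 := by
    intro i
    have := congrFun hMv i
    rwa [pencilMatrix, Matrix.add_mulVec, Matrix.smul_mulVec] at this
  refine not_isTorsionFree_of_sequence (x := x) (fun n j => (v j).coeff n) ?_ ?_ ?_ h
  · by_contra! h'
    refine hv (funext fun j => Polynomial.ext fun n => ?_)
    exact congrFun (h' n) j
  · ext i
    have := congrArg (fun f => coeff f 0) (hi i)
    rw [happ]
    simpa [hco] using this
  · intro n
    ext i
    have := congrArg (fun f => coeff f (n + 1)) (hi i)
    rw [happ, happ]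
    simpa [hco, coeff_X_mul] using this

/-- The closure is infinite, so the nonzero determinant has a non-root there; over a finite `K` it
might vanish at every point. -/
theorem exists_bijective_geom {d : ℕ} {x : Rep K (Fin d → K) (Fin d → K)}
    (h : IsTorsionFree x) :
    ∃ t : AlgebraicClosure K, Function.Bijective (geom x 0 + t • geom x 1) := by
  have hdet := det_pencilMatrix_ne_zero h
  have hmap : (pencilMatrix x).det.map (algebraMap K (AlgebraicClosure K)) ≠ 0 :=
    (Polynomial.map_ne_zero_iff (algebraMap K (AlgebraicClosure K)).injective).2 hdet
  obtain ⟨t, ht⟩ : ∃ t,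
      ((pencilMatrix x).det.map (algebraMap K (AlgebraicClosure K))).eval t ≠ 0 := by
    by_contra! h'
    exact hmap (Polynomial.funext fun t => by rw [h', eval_zero])
  refine ⟨t, ?_⟩
  let b := (Pi.basisFun K (Fin d)).baseChange (AlgebraicClosure K)
  have hm : LinearMap.toMatrix b b (geom x 0 + t • geom x 1) =
      (eval₂RingHom (algebraMap K (AlgebraicClosure K)) t).mapMatrix (pencilMatrix x) := by
    ext i j
    simp [LinearMap.toMatrix_apply, b, geom, pencilMatrix, Module.Basis.baseChange_apply,
      LinearMap.toMatrix'_apply]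
    rw [Algebra.smul_def, Algebra.smul_def, mul_one]
  have hd : LinearMap.det (geom x 0 + t • geom x 1) ≠ 0 := by
    rw [← LinearMap.det_toMatrix b, hm, ← RingHom.map_det, coe_eval₂RingHom, ← eval_map]
    exact ht
  exact (LinearMap.equivOfDetNeZero _ hd).bijective

theorem isRegularRep_geom_iff {d : ℕ} (x : Rep K (Fin d → K) (Fin d → K)) :
    IsRegularRep (geom x) ↔ IsTorsionFree x := by
  constructor
  · intro h
    obtain ⟨t, ht⟩ := exists_bijective_of_isRegularRep h
    exact isTorsionFree_of_injective ht.injective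
  · intro h
    obtain ⟨t, ht⟩ := exists_bijective_geom h
    exact isRegularRep_of_bijective ht

end Geometric

theorem rho_eq_smul_indTorsionFree (K : Type*) [Field K] [Finite K] {R : Type*} [Field R] (ε : R)
    (d : ℕ) :
    rho K ε d = ε⁻¹ ^ Module.finrank K (E K (d, d)) • indTorsionFree K ε (d, d) := by
  classical
  ext e x
  change ite _ _ _ = _ * ite _ _ _
  by_cases h : e = (d, d)
  · subst h
    rw [isRegularRep_geom_iff (d := d) x]
    simp
  · simp [h]

end Kronecker

end

theorem mainTheorem8 (p ℓ : ℕ) [Fact p.Prime] [Fact ℓ.Prime] (hℓp : ℓ ≠ p)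
    (K : Type*) [Field K] [Finite K] [CharP K p]
    (ε : AlgebraicClosure ℚ_[ℓ]) (hε : ε ^ 2 = (Nat.card K : AlgebraicClosure ℚ_[ℓ])) (d : ℕ) :
    Kronecker.rho K ε d ∈ Kronecker.compositionAlgebra K ε ∧
    Kronecker.rho K ε d ∈ Algebra.adjoin (AlgebraicClosure ℚ_[ℓ])
      ({Kronecker.theta K ε 0, Kronecker.theta K ε 1} :
        Set (Kronecker.HallAlgebra K (AlgebraicClosure ℚ_[ℓ]) ε)) := by
  have : CharZero (AlgebraicClosure ℚ_[ℓ]) :=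
    charZero_of_injective_algebraMap (algebraMap ℚ_[ℓ] _).injective
  have h : Kronecker.rho K ε d ∈ Kronecker.compositionAlgebra K ε := by
    rw [Kronecker.rho_eq_smul_indTorsionFree]
    exact Kronecker.inv_pow_smul_mem_compositionAlgebra K _
      (Kronecker.indTorsionFree_mem_compositionAlgebra K hε _)
  exact ⟨h, Kronecker.mem_adjoin_theta_of_mem_compositionAlgebra K h⟩
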